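/- Let $\Sigma$ be a finite alphabet and let $\vdash,\dashv\notin\Sigma$ be two boundary markers; put $\overline{\Sigma}=\Sigma\cup\{\vdash,\dashv\}$. A two-way two-tape automaton over $\Sigma$ consists of a finite set $Q$ of states, sets $I,F\subseteq Q$ of initial and final states, and a set $\Delta\subseteq (Q\times\overline{\Sigma}\times\overline{\Sigma})\times(Q\times\{-1,0,1\}\times\{-1,0,1\})$ of transitions $(p,a_1,a_2)\to(q,d_1,d_2)$ such that, for $i=1,2$, $a_i={\vdash}$ implies $d_i\neq -1$ and $a_i={\dashv}$ implies $d_i\neq 1$. On input $(u,v)\in\Sigma^*\times\Sigma^*$ the tapes contain ${\vdash}u{\dashv}$ and ${\vdash}v{\dashv}$, with positions numbered from $0$. A configuration is a triple $(q,i,j)\in Q\times\mathbb{N}\times\mathbb{N}$; $(q',i+d_1,j+d_2)$ is a successor of $(q,i,j)$ if $(q,a_1,a_2)\to(q',d_1,d_2)$ is a transition, where $a_1,a_2$ are the symbols at position $i$ of the first and position $j$ of the second tape. A configuration is initial if $q\in I$ and $i=j=0$. A (non-deterministic) automaton accepts $(u,v)$ if there is a finite sequence of successive configurations that starts in an initial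 one and contains a final state. It is deterministic if it has at most one initial state and, for every $(p,a_1,a_2)\in Q\times\overline{\Sigma}\times\overline{\Sigma}$, at most one transition from $(p,a_1,a_2)$. An alternating automaton has its states partitioned into existential and universal ones, and accepts $(u,v)$ if there is a finite tree labelled by configurations whose root is labelled by an initial configuration, such that each inner node with an existential label has exactly one son, labelled by a successor of it, each inner node with a universal label has exactly one son for each successor, labelled by that successor, and each leaf is labelled by a configuration with a final state or by a universal configuration without successors. The relation recognized by an automaton is the set of pairs in $\Sigma^*\times\Sigma^*$ that it accepts. Theorem. The class of relations recognized by deterministic two-way two-tape automata, the class of those recognized by non-deterministic ones, and the class of those recognized by alternating ones are each not closed under composition. That is, there is a finite alphabet $\Sigma$ such that, for each of these three classes of relations on $\Sigma^*$, there are relations $R,S$ in the class whose composition $\{(u,w)\mid \exists v\in\Sigma^*,\ (u,v)\in R \text{ and } (v,w)\in S\}$ is not in the class. -/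

import Mathlib

namespace TwoTape

/-- Symbols that can be scanned on a tape: the letters of the alphabet `α` and the two
boundary markers, which are not letters. -/
inductive TapeSymbol (α : Type) : Type
  | beginMark : TapeSymbol α
  | letter (a : α) : TapeSymbol α
  | endMark : TapeSymbol α

/-- Head moves. -/
inductive Move : Type
  | left
  | stay
  | right

/-- The displacement `-1`, `0`, `1` of a head caused by a move. -/
def Move.shift : Move → ℤ
  | .left => -1
  | .stay => 0
  | .right => 1

/-- The move does not cross a word boundary when the head scans the given symbol. -/
def Move.Allowed {α : Type} (a : TapeSymbol α) (d : Move) : Prop :=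
  (a = .beginMark → d ≠ .left) ∧ (a = .endMark → d ≠ .right)

/-- The word `u` written on a tape between its two boundary markers. -/
def tape {α : Type} (u : List α) : List (TapeSymbol α) :=
  .beginMark :: (u.map .letter ++ [.endMark])

/-- A (non-deterministic) two-way two-tape automaton with alphabet `α` and set of states `Q`
(both are required to be finite wherever automata are used).
`trans p a b q d e` is the transition from `p` to `q` that reads `a` on the first tape and `b` on
the second, and moves the heads by `d` and `e`. -/
structure Automaton (α Q : Type) where
  trans : Q → TapeSymbol α → TapeSymbol α → Q → Move → Move → Prop
  init : Set Q
  final : Set Q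
  allowed : ∀ {p a b q d e}, trans p a b q d e → d.Allowed a ∧ e.Allowed b

/-- A configuration: the current state and the positions of the two heads
(the begin marker is at position `0`). -/
structure Config (Q : Type) where
  state : Q
  fst : ℕ
  snd : ℕ

namespace Automaton

variable {α Q : Type}

/-- `c'` is a successor of the configuration `c` on input `(u, v)`. -/
def Step (A : Automaton α Q) (u v : List α) (c c' : Config Q) : Prop :=
  ∃ a b d e, (tape u)[c.fst]? = some a ∧ (tape v)[c.snd]? = some b ∧
    A.trans c.state a b c'.state d e ∧
    (c'.fst : ℤ) = c.fst + d.shift ∧ (c'.snd : ℤ) = c.snd + e.shift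

/-- Initial configurations: an initial state, with both heads on the begin markers. -/
def IsInitial (A : Automaton α Q) (c : Config Q) : Prop :=
  c.state ∈ A.init ∧ c.fst = 0 ∧ c.snd = 0

/-- The finite sequence `l` of configurations is an accepting run on `(u, v)`: it starts in an
initial configuration, consists of successive configurations, and contains a final state. -/
def IsAcceptingRun (A : Automaton α Q) (u v : List α) (l : List (Config Q)) : Prop :=
  (∃ c, l.head? = some c ∧ A.IsInitial c) ∧ l.IsChain (A.Step u v) ∧
    ∃ c ∈ l, c.state ∈ A.final

/-- The relation accepted by a non-deterministic automaton. -/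
def accepted (A : Automaton α Q) : SetRel (List α) (List α) :=
  {p | ∃ l, A.IsAcceptingRun p.1 p.2 l}

/-- Determinism: at most one initial state, and at most one transition from any given state
on any given pair of scanned symbols (markers included). -/
def IsDeterministic (A : Automaton α Q) : Prop :=
  A.init.Subsingleton ∧
    ∀ {p a b q q' d d' e e'}, A.trans p a b q d e → A.trans p a b q' d' e' →
      q = q' ∧ d = d' ∧ e = e'

end Automaton

/-- Finite ordered trees with nodes labelled in `C`. -/
inductive RunTree (C : Type) : Type
  | node (c : C) (sons : List (RunTree C)) : RunTree C

/-- The label of the root. -/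
def RunTree.root {C : Type} : RunTree C → C
  | .node c _ => c

/-- An alternating automaton: the states are partitioned into the universal ones and the
existential ones (the states that are not universal). -/
structure AltAutomaton (α Q : Type) extends Automaton α Q where
  univ : Set Q

namespace AltAutomaton

variable {α Q : Type}

/-- `A.IsAcceptingTree u v t`: the finite tree `t` satisfies, on input `(u, v)`, the conditions of
an accepting run, except that its root need not be an initial configuration.
* A leaf may carry any configuration whose state is final.
* An inner node with an existential configuration has one son, labelled by a successor.
* A node with a universal configuration has one son for each of its successors (with pairwise
  different labels); it is a leaf if there are no successors. -/
inductive IsAcceptingTree (A : AltAutomaton α Q) (u v : List α) : RunTree (Config Q) → Prop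
  | final (c : Config Q) (hc : c.state ∈ A.final) : IsAcceptingTree A u v (.node c [])
  | exist (c : Config Q) (t : RunTree (Config Q)) (hc : c.state ∉ A.univ)
      (hs : A.Step u v c t.root) (ht : IsAcceptingTree A u v t) :
      IsAcceptingTree A u v (.node c [t])
  | all (c : Config Q) (ts : List (RunTree (Config Q))) (hc : c.state ∈ A.univ)
      (hd : (ts.map RunTree.root).Nodup)
      (hs : ∀ c', c' ∈ ts.map RunTree.root ↔ A.Step u v c c')
      (ht : ∀ t ∈ ts, IsAcceptingTree A u v t) :
      IsAcceptingTree A u v (.node c ts)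

/-- The relation accepted by an alternating automaton. -/
def accepted (A : AltAutomaton α Q) : SetRel (List α) (List α) :=
  {p | ∃ t, A.IsInitial t.root ∧ A.IsAcceptingTree p.1 p.2 t}

end AltAutomaton

/-- The class of relations recognized by deterministic automata. -/
def DetRec (α : Type) : Set (SetRel (List α) (List α)) :=
  {R | ∃ (Q : Type) (_ : Finite Q) (A : Automaton α Q), A.IsDeterministic ∧ A.accepted = R}

/-- The class of relations recognized by non-deterministic automata. -/
def NondetRec (α : Type) : Set (SetRel (List α) (List α)) :=
  {R | ∃ (Q : Type) (_ : Finite Q) (A : Automaton α Q), A.accepted = R}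

/-- The class of relations recognized by alternating automata. -/
def AltRec (α : Type) : Set (SetRel (List α) (List α)) :=
  {R | ∃ (Q : Type) (_ : Finite Q) (A : AltAutomaton α Q), A.accepted = R}

/-- A class of relations is closed under composition: with `R` and `S` it contains
`{(u, w) | ∃ v, (u, v) ∈ R ∧ (v, w) ∈ S}`. -/
def ClosedUnderComposition {X : Type} (𝒞 : Set (SetRel X X)) : Prop :=
  ∀ R ∈ 𝒞, ∀ S ∈ 𝒞, R.comp S ∈ 𝒞

end TwoTape

/-! One counterexample serves all three classes: a relation that is deterministic composed with the
total relation gives one that is not even alternating. Composing with the total relation projects: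
`(u, w)` is in the composition iff `u` is related to some `v`. A deterministic automaton can use `v`
as a yardstick: on `(aⁿbᵐ, v)` it checks that both blocks have the length of `v`, so a suitable `v`
exists iff `n = m` (`eq_of_blocks_mem_accepted`, `blocks_mem_accepted`).

In the composition `v` is gone, and `w` may be empty. With `w` fixed, the state and the second head
together form a finite control, so an alternating automaton acts as a two-way one-tape automaton on
`u` and recognizes a regular language. The regularity argument is a Myhill–Nerode one: a prefix
influences acceptance only through its `behaviour`, of which there are finitely many. Hence some
`aᵐ` and `aⁿ` with `m ≠ n` are interchangeable, and `aᵐbᵐ` forces `aⁿbᵐ` to be accepted. -/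

namespace TwoTape

variable {α Q : Type}

/-! ### Symbols on a tape -/

section Tape

theorem getElem?_tape_eq_beginMark {u : List α} {i : ℕ} :
    (tape u)[i]? = some .beginMark ↔ i = 0 := by
  rcases i with _ | i
  · simp [tape]
  · simp [tape, List.getElem?_append, List.getElem?_singleton]
    split_ifs <;> simp

theorem getElem?_tape_eq_endMark {u : List α} {i : ℕ} :
    (tape u)[i]? = some .endMark ↔ i = u.length + 1 := by
  rcases i with _ | i
  · simp [tape]
  · simp only [tape, List.getElem?_cons_succ, List.getElem?_append, List.length_map,
      List.getElem?_map, List.getElem?_singleton]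
    split_ifs <;> simp <;> omega

theorem getElem?_tape_eq_letter {u : List α} {i : ℕ} {a : α} :
    (tape u)[i]? = some (.letter a) ↔ ∃ k, i = k + 1 ∧ u[k]? = some a := by
  rcases i with _ | i
  · simp [tape]
  · simp only [tape, List.getElem?_cons_succ, List.getElem?_append, List.length_map,
      List.getElem?_map, List.getElem?_singleton]
    split_ifs with h h' <;> simp
    · rw [List.getElem?_eq_none (by omega)]
      simp
    · rw [List.getElem?_eq_none (by omega)]
      simp

theorem lt_length_of_getElem?_tape {u : List α} {i : ℕ} {s : TapeSymbol α}
    (h : (tape u)[i]? = some s) : i < u.length + 2 := by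
  have := (List.getElem?_eq_some_iff.1 h).1
  simpa [tape, Nat.lt_succ_iff] using this

theorem getElem?_tape_append_left (x y : List α) {i : ℕ} (h : i ≤ x.length) :
    (tape (x ++ y))[i]? = (tape x)[i]? := by
  rcases i with _ | i
  · rfl
  · have h' : i < x.length := h
    simp [tape, List.getElem?_append, h']

theorem getElem?_tape_append_right (x y : List α) (k : ℕ) :
    (tape (x ++ y))[x.length + 1 + k]? = (y.map TapeSymbol.letter ++ [.endMark])[k]? := by
  have h : x.length + 1 + k = (x.length + k) + 1 := by omega
  rw [h]
  simp only [tape, List.getElem?_cons_succ, List.map_append, List.append_assoc]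
  rw [List.getElem?_append_right (by simp)]
  simp

end Tape

/-! ### Steps, their locality, and reachability -/

namespace Automaton

/-- The restriction on moves at the end marker keeps the head on the tape. This bound is what makes
the positions of the second head a finite set once the second word is fixed. -/
theorem Step.snd_lt {A : Automaton α Q} {u v : List α} {c c' : Config Q} (h : A.Step u v c c') :
    c'.snd < v.length + 2 := by
  obtain ⟨a, b, d, e, -, hb, ht, -, he⟩ := h
  have hlt := lt_length_of_getElem?_tape hb
  have hal := (A.allowed ht).2.2
  rcases e with _ | _ | _ <;> simp only [Move.shift] at he
  · omega
  · omega
  · have : c.snd ≠ v.length + 1 := by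
      intro h
      rw [getElem?_tape_eq_endMark.2 h] at hb
      exact hal (Option.some.inj hb).symm rfl
    omega

theorem Step.fst_lt {A : Automaton α Q} {u v : List α} {c c' : Config Q} (h : A.Step u v c c') :
    c'.fst < u.length + 2 := by
  obtain ⟨a, b, d, e, ha, -, ht, hd, -⟩ := h
  have hlt := lt_length_of_getElem?_tape ha
  have hal := (A.allowed ht).1.2
  rcases d with _ | _ | _ <;> simp only [Move.shift] at hd
  · omega
  · omega
  · have : c.fst ≠ u.length + 1 := by
      intro h
      rw [getElem?_tape_eq_endMark.2 h] at ha
      exact hal (Option.some.inj ha).symm rfl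
    omega

theorem Step.fst_near {A : Automaton α Q} {u v : List α} {c c' : Config Q}
    (h : A.Step u v c c') : c'.fst ≤ c.fst + 1 ∧ c.fst ≤ c'.fst + 1 := by
  obtain ⟨a, b, d, e, -, -, -, hd, -⟩ := h
  rcases d with _ | _ | _ <;> simp only [Move.shift] at hd <;> omega

theorem finite_successors [Finite Q] (A : Automaton α Q) (u v : List α) (c : Config Q) :
    {c' | A.Step u v c c'}.Finite := by
  refine Set.Finite.subset (Set.finite_range
    fun p : Q × Fin (u.length + 2) × Fin (v.length + 2) => (⟨p.1, p.2.1, p.2.2⟩ : Config Q)) ?_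
  intro c' h
  exact ⟨(c'.state, ⟨c'.fst, h.fst_lt⟩, ⟨c'.snd, h.snd_lt⟩), rfl⟩

/-- On the part of the tape that holds a common prefix, steps do not see the rest of the word. -/
theorem step_append_left_iff (A : Automaton α Q) (x y v : List α) {c c' : Config Q}
    (h : c.fst ≤ x.length) : A.Step (x ++ y) v c c' ↔ A.Step x v c c' := by
  simp only [Step, getElem?_tape_append_left x y h]

/-- On the part of the tape that holds a common suffix, steps do not see the prefix. -/
theorem step_append_right_iff (A : Automaton α Q) (x x' y v : List α) {p q : Q} {i i' k k' j j' : ℕ}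
    (hi : i + x'.length = i' + x.length) (hk : k + x'.length = k' + x.length)
    (h : x.length < i) :
    A.Step (x ++ y) v ⟨p, i, j⟩ ⟨q, k, j'⟩ ↔ A.Step (x' ++ y) v ⟨p, i', j⟩ ⟨q, k', j'⟩ := by
  obtain ⟨l, rfl⟩ : ∃ l, i = x.length + 1 + l := ⟨i - (x.length + 1), by omega⟩
  obtain rfl : i' = x'.length + 1 + l := by omega
  have (d : ℤ) : ((k : ℤ) = (x.length + 1 + l : ℕ) + d) ↔
      ((k' : ℤ) = (x'.length + 1 + l : ℕ) + d) := by omega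
  simp only [Step, getElem?_tape_append_right, this]

theorem mem_accepted_iff {A : Automaton α Q} {u v : List α} :
    (u, v) ∈ A.accepted ↔ ∃ c c', A.IsInitial c ∧
      Relation.ReflTransGen (A.Step u v) c c' ∧ c'.state ∈ A.final := by
  constructor
  · rintro ⟨l, ⟨c, hl, hc⟩, hch, c', hc', hf⟩
    refine ⟨c, c', hc, ?_, hf⟩
    clear hc hf
    induction l generalizing c with
    | nil => simp at hl
    | cons a l ih =>
      obtain rfl : a = c := by simpa using hl
      rcases List.mem_cons.1 hc' with rfl | hm
      · exact .refl
      · rcases l with _ | ⟨b, l⟩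
        · simp at hm
        · rw [List.isChain_cons_cons] at hch
          exact .head hch.1 (ih b rfl hch.2 hm)
  · rintro ⟨c, c', hc, hr, hf⟩
    obtain ⟨l, hch, hl⟩ := List.exists_isChain_cons_of_relationReflTransGen hr
    exact ⟨c :: l, ⟨c, rfl, hc⟩, hch, c', hl ▸ List.getLast_mem _, hf⟩

end Automaton

/-! ### Alternating acceptance and behaviours of prefixes -/

namespace AltAutomaton

/-- The configurations of an alternating automaton from which it accepts. -/
inductive Accepts (A : AltAutomaton α Q) (u v : List α) : Config Q → Prop
  | final (c : Config Q) (hc : c.state ∈ A.final) : Accepts A u v c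
  | exist (c c' : Config Q) (hc : c.state ∉ A.univ) (hs : A.Step u v c c')
      (h : Accepts A u v c') : Accepts A u v c
  | all (c : Config Q) (hc : c.state ∈ A.univ)
      (h : ∀ c', A.Step u v c c' → Accepts A u v c') : Accepts A u v c

/-- Trees are only witnesses for the inductive predicate. A universal node needs a finite
duplicate-free list of sons, which exists because a configuration has finitely many successors. -/
theorem accepts_iff_exists_tree [Finite Q] {A : AltAutomaton α Q} {u v : List α} {c : Config Q} :
    A.Accepts u v c ↔ ∃ t, RunTree.root t = c ∧ A.IsAcceptingTree u v t := by
  constructor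
  · intro h
    induction h with
    | final c hc => exact ⟨.node c [], rfl, .final c hc⟩
    | exist c c' hc hs _ ih =>
      obtain ⟨t, rfl, ht⟩ := ih
      exact ⟨.node c [t], rfl, .exist c t hc hs ht⟩
    | all c hc _ ih =>
      have : Nonempty (RunTree (Config Q)) := ⟨.node c []⟩
      choose! f hf using ih
      set l := (A.finite_successors u v c).toFinset.toList with hl
      have mem_l (c') : c' ∈ l ↔ A.Step u v c c' := by simp [hl]
      have hmap : (l.map f).map RunTree.root = l := by
        rw [List.map_map]
        exact (List.map_congr_left fun c' h => (hf c' ((mem_l c').1 h)).1).trans (List.map_id l)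
      refine ⟨.node c (l.map f), rfl, .all c _ hc ?_ ?_ ?_⟩
      · rw [hmap]; exact Finset.nodup_toList _
      · rw [hmap]; exact mem_l
      · intro t ht
        obtain ⟨c', h, rfl⟩ := List.mem_map.1 ht
        exact (hf c' ((mem_l c').1 h)).2
  · rintro ⟨t, rfl, ht⟩
    induction ht with
    | final c hc => exact .final c hc
    | exist c t hc hs _ ih => exact .exist c _ hc hs ih
    | all c ts hc _ hs _ ih =>
      refine .all c hc fun c' h => ?_
      obtain ⟨t, ht, rfl⟩ := List.mem_map.1 ((hs c').2 h)
      exact ih t ht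

theorem mem_accepted_iff [Finite Q] {A : AltAutomaton α Q} {u v : List α} :
    (u, v) ∈ A.accepted ↔ ∃ q ∈ A.init, A.Accepts u v ⟨q, 0, 0⟩ := by
  constructor
  · rintro ⟨t, ⟨hq, h₁, h₂⟩, ht⟩
    refine ⟨_, hq, accepts_iff_exists_tree.2 ⟨t, ?_, ht⟩⟩
    -- This rewrites both zeros to the first position; the second one is then turned back so that it
    -- can become the second position, and eta closes the goal.
    rw [← h₁]
    nth_rw 2 [h₁]
    rw [← h₂]
  · rintro ⟨q, hq, h⟩
    obtain ⟨t, hr, ht⟩ := accepts_iff_exists_tree.1 h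
    exact ⟨t, hr ▸ ⟨hq, rfl, rfl⟩, ht⟩

/-- Acceptance from a configuration with the first head on the prefix `x` of the first word, where
leaving the prefix to the right counts as acceptance if and only if the state and the position of
the second head belong to `E`. -/
inductive PrefixAccepts (A : AltAutomaton α Q) (x w : List α) (E : Set (Q × Fin (w.length + 2))) :
    Config Q → Prop
  | exit (c : Config Q) (hi : c.fst = x.length + 1) (hj : c.snd < w.length + 2)
      (hE : (c.state, ⟨c.snd, hj⟩) ∈ E) : PrefixAccepts A x w E c
  | final (c : Config Q) (hi : c.fst ≤ x.length) (hc : c.state ∈ A.final) : PrefixAccepts A x w E c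
  | exist (c c' : Config Q) (hi : c.fst ≤ x.length) (hc : c.state ∉ A.univ)
      (hs : A.Step x w c c') (h : PrefixAccepts A x w E c') : PrefixAccepts A x w E c
  | all (c : Config Q) (hi : c.fst ≤ x.length) (hc : c.state ∈ A.univ)
      (h : ∀ c', A.Step x w c c' → PrefixAccepts A x w E c') : PrefixAccepts A x w E c

/-- What the rest of the word can observe of the prefix `x`: for each set of accepting exits, the
accepting pairs of a state and a position of the second head, with the first head on the begin
marker and with the first head on the last symbol of the prefix. -/
def behaviour (A : AltAutomaton α Q) (w x : List α) (E : Set (Q × Fin (w.length + 2))) :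
    Set (Q × Fin (w.length + 2)) × Set (Q × Fin (w.length + 2)) :=
  ({p | A.PrefixAccepts x w E ⟨p.1, 0, p.2⟩}, {p | A.PrefixAccepts x w E ⟨p.1, x.length, p.2⟩})

/-- Inside the prefix the steps are the same whatever follows, so it suffices that every exit in `E`
is accepting. -/
theorem PrefixAccepts.accepts {A : AltAutomaton α Q} {x y w : List α}
    {E : Set (Q × Fin (w.length + 2))} {c : Config Q} (h : A.PrefixAccepts x w E c)
    (hE : ∀ p ∈ E, A.Accepts (x ++ y) w ⟨p.1, x.length + 1, p.2⟩) : A.Accepts (x ++ y) w c := by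
  induction h with
  | exit c hi hj h =>
    obtain ⟨q, i, j⟩ := c
    obtain rfl : i = x.length + 1 := hi
    exact hE _ h
  | final c _ hc => exact .final c hc
  | exist c c' hi hc hs _ ih =>
    exact .exist c c' hc ((A.step_append_left_iff x y w hi).2 hs) ih
  | all c hi hc _ ih =>
    exact .all c hc fun c' hs => ih c' ((A.step_append_left_iff x y w hi).1 hs)

/-- Prefixes with the same behaviour can be exchanged. -/
theorem Accepts.of_behaviour_eq {A : AltAutomaton α Q} {x x' w : List α}
    (hb : A.behaviour w x = A.behaviour w x') {y : List α} {q : Q} {j : ℕ}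
    (hj : j < w.length + 2) (h : A.Accepts (x ++ y) w ⟨q, 0, j⟩) :
    A.Accepts (x' ++ y) w ⟨q, 0, j⟩ := by
  -- The exits are those accepting after `x'`, the new prefix, although `E` is also used with `x`;
  -- this makes acceptance within `x'` sound for the whole word.
  set E : Set (Q × Fin (w.length + 2)) :=
    {p | A.Accepts (x' ++ y) w ⟨p.1, x'.length + 1, p.2⟩} with hE
  have sound {c} (h : A.PrefixAccepts x' w E c) : A.Accepts (x' ++ y) w c :=
    h.accepts fun _ hp => hp
  have hbE := congrFun hb E
  have start {q j} (hj : j < w.length + 2) (h : A.PrefixAccepts x w E ⟨q, 0, j⟩) :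
      A.PrefixAccepts x' w E ⟨q, 0, j⟩ := by
    have : (q, ⟨j, hj⟩) ∈ (A.behaviour w x E).1 := h
    rw [hbE] at this
    exact this
  have border {q j} (hj : j < w.length + 2) (h : A.PrefixAccepts x w E ⟨q, x.length, j⟩) :
      A.PrefixAccepts x' w E ⟨q, x'.length, j⟩ := by
    have : (q, ⟨j, hj⟩) ∈ (A.behaviour w x E).2 := h
    rw [hbE] at this
    exact this
  -- Induction on acceptance of `x ++ y`: within the prefix, acceptance becomes acceptance relative
  -- to `E`; within `y`, the configuration is carried over with its position shifted. A head coming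
  -- back from `y` lands on the last symbol of the prefix, where `border` applies.
  have key (c : Config Q) (h : A.Accepts (x ++ y) w c) (hj : c.snd < w.length + 2) :
      (c.fst ≤ x.length → A.PrefixAccepts x w E c) ∧
        ∀ i', c.fst + x'.length = i' + x.length → x.length < c.fst →
          A.Accepts (x' ++ y) w ⟨c.state, i', c.snd⟩ := by
    -- the induction hypothesis, in the form in which steps use it
    have combine {c : Config Q} (hj : c.snd < w.length + 2)
        (h : (c.fst ≤ x.length → A.PrefixAccepts x w E c) ∧
          ∀ i', c.fst + x'.length = i' + x.length → x.length < c.fst →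
            A.Accepts (x' ++ y) w ⟨c.state, i', c.snd⟩) :
        (c.fst ≤ x.length + 1 → A.PrefixAccepts x w E c) ∧
          ∀ i', c.fst + x'.length = i' + x.length → x.length ≤ c.fst →
            A.Accepts (x' ++ y) w ⟨c.state, i', c.snd⟩ := by
      refine ⟨fun hi => ?_, fun i' hi' hi => ?_⟩
      · rcases Nat.lt_or_ge x.length c.fst with hlt | hle
        · exact .exit c (by omega) hj (h.2 (x'.length + 1) (by omega) hlt)
        · exact h.1 hle
      · rcases Nat.lt_or_ge x.length c.fst with hlt | hle
        · exact h.2 i' hi' hlt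
        · obtain ⟨q, i, j⟩ := c
          obtain rfl : i = x.length := le_antisymm hle hi
          obtain rfl : i' = x'.length := by omega
          exact sound (border hj (h.1 le_rfl))
    induction h with
    | final c hc => exact ⟨fun hi => .final c hi hc, fun _ _ _ => .final _ hc⟩
    | exist c c' hc hs _ ih =>
      have ih := combine hs.snd_lt (ih hs.snd_lt)
      have hn := hs.fst_near
      refine ⟨fun hi => .exist c c' hi hc ((A.step_append_left_iff x y w hi).1 hs)
        (ih.1 (by omega)), fun i' hi' hi => ?_⟩
      obtain ⟨k', hk'⟩ : ∃ k', c'.fst + x'.length = k' + x.length :=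
        ⟨c'.fst + x'.length - x.length, by omega⟩
      exact .exist _ ⟨c'.state, k', c'.snd⟩ hc
        ((A.step_append_right_iff x x' y w hi' hk' hi).1 hs) (ih.2 k' hk' (by omega))
    | all c hc _ ih =>
      refine ⟨fun hi => .all c hi hc fun c' hs => ?_,
        fun i' hi' hi => .all _ hc fun c' hs => ?_⟩
      · have hs' := (A.step_append_left_iff x y w hi).2 hs
        have hn := hs.fst_near
        exact (combine hs.snd_lt (ih c' hs' hs.snd_lt)).1 (by omega)
      · have hn := hs.fst_near
        simp only at hn
        -- A universal configuration requires every successor over `x' ++ y`, so each is pulled back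
        -- to one over `x ++ y`. The subtraction does not truncate, since one step from `y` goes no
        -- further left than position `x'.length`.
        obtain ⟨k, hk⟩ : ∃ k, k + x'.length = c'.fst + x.length :=
          ⟨c'.fst + x.length - x'.length, by omega⟩
        have hs' : A.Step (x ++ y) w c ⟨c'.state, k, c'.snd⟩ :=
          (A.step_append_right_iff x x' y w hi' hk hi).2 hs
        exact (combine hs'.snd_lt (ih _ hs' hs'.snd_lt)).2 c'.fst hk (by simp only; omega)
  exact sound (start hj ((key _ h hj).1 (Nat.zero_le _)))

/-- A fixed second word leaves only finitely many behaviours: among infinitely many prefixes, two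
can be exchanged. -/
theorem exists_ne_forall_append_mem_accepted [Finite Q] (A : AltAutomaton α Q) (w : List α)
    (x : ℕ → List α) : ∃ m n, m ≠ n ∧
      ∀ y, (x m ++ y, w) ∈ A.accepted → (x n ++ y, w) ∈ A.accepted := by
  obtain ⟨m, n, hne, hmn⟩ := Finite.exists_ne_map_eq_of_infinite fun n => A.behaviour w (x n)
  refine ⟨m, n, hne, fun y h => ?_⟩
  obtain ⟨q, hq, h⟩ := mem_accepted_iff.1 h
  exact mem_accepted_iff.2 ⟨q, hq, h.of_behaviour_eq hmn (by omega)⟩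

end AltAutomaton

/-! ### Inclusions between the classes, and the total relation -/

theorem detRec_subset_nondetRec : DetRec α ⊆ NondetRec α :=
  fun _ ⟨Q, hQ, A, _, h⟩ => ⟨Q, hQ, A, h⟩

theorem nondetRec_subset_altRec : NondetRec α ⊆ AltRec α := by
  rintro _ ⟨Q, hQ, A, rfl⟩
  refine ⟨Q, hQ, { A with univ := ∅ }, Set.ext fun ⟨u, v⟩ => ?_⟩
  rw [AltAutomaton.mem_accepted_iff, Automaton.mem_accepted_iff]
  constructor
  · rintro ⟨q, hq, h⟩
    suffices ∃ c', Relation.ReflTransGen (A.Step u v) ⟨q, 0, 0⟩ c' ∧ c'.state ∈ A.final by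
      obtain ⟨c', hr, hf⟩ := this
      exact ⟨_, c', ⟨hq, rfl, rfl⟩, hr, hf⟩
    generalize (⟨q, 0, 0⟩ : Config Q) = c at h
    induction h with
    | final c hc => exact ⟨c, .refl, hc⟩
    | exist c c' _ hs _ ih =>
      obtain ⟨c'', hr, hf⟩ := ih
      exact ⟨c'', .head hs hr, hf⟩
    | all c hc => exact hc.elim
  · rintro ⟨⟨q, i, j⟩, c', ⟨hq, rfl, rfl⟩, hr, hf⟩
    refine ⟨q, hq, ?_⟩
    generalize (⟨q, 0, 0⟩ : Config Q) = c at hr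
    induction hr using Relation.ReflTransGen.head_induction_on with
    | refl => exact .final _ hf
    | head hs _ ih => exact .exist _ _ (Set.notMem_empty _) hs ih

theorem univ_mem_detRec : (Set.univ : SetRel (List α) (List α)) ∈ DetRec α := by
  refine ⟨Unit, inferInstance, ⟨fun _ _ _ _ _ _ => False, Set.univ, Set.univ, False.elim⟩,
    ⟨Set.subsingleton_of_subsingleton, fun h => h.elim⟩, Set.eq_univ_of_forall fun ⟨u, v⟩ => ?_⟩
  exact Automaton.mem_accepted_iff.2
    ⟨⟨(), 0, 0⟩, _, ⟨Set.mem_univ _, rfl, rfl⟩, .refl, Set.mem_univ _⟩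

/-! ### The deterministic automaton comparing two blocks -/

/-- States of `blockAutomaton`. -/
inductive BlockState : Type
  | first
  | second
  | done

instance : Finite BlockState :=
  Finite.of_surjective ![BlockState.first, .second, .done] fun
    | .first => ⟨0, rfl⟩
    | .second => ⟨1, rfl⟩
    | .done => ⟨2, rfl⟩

/-- The transition table of `blockAutomaton`. -/
def blockNext : BlockState → TapeSymbol Bool → TapeSymbol Bool → Option (BlockState × Move × Move)
  | .first, .beginMark, .beginMark => some (.first, .right, .right)
  | .first, .letter false, .letter _ => some (.first, .right, .right)
  | .first, .letter true, .endMark => some (.second, .stay, .left)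
  | .first, .endMark, .endMark => some (.second, .stay, .left)
  | .second, .letter true, .letter _ => some (.second, .right, .left)
  | .second, .endMark, .beginMark => some (.done, .stay, .stay)
  | _, _, _ => none

/-- A deterministic automaton that compares the lengths of the two blocks of a word `aⁿbᵐ` on the
first tape with the length of the second word: the second head runs to the right during the first
block and back to the left during the second one. Here `a` is `false` and `b` is `true`. -/
def blockAutomaton : Automaton Bool BlockState where
  trans p a b q d e := blockNext p a b = some (q, d, e)
  init := {.first}
  final := {.done}
  allowed {p a b q d e} h := by
    unfold blockNext at h
    split at h <;> simp_all [Move.Allowed] <;> grind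

theorem blockAutomaton_isDeterministic : blockAutomaton.IsDeterministic := by
  refine ⟨Set.subsingleton_singleton, fun {p a b q q' d d' e e'} h h' => ?_⟩
  have : some (q, d, e) = some (q', d', e') := h.symm.trans h'
  simpa using this

/-- The word `aⁿbᵐ`. -/
def blocks (n m : ℕ) : List Bool := List.replicate n false ++ List.replicate m true

theorem length_blocks (n m : ℕ) : (blocks n m).length = n + m := by simp [blocks]

theorem getElem?_blocks_eq_false {n m k : ℕ} : (blocks n m)[k]? = some false ↔ k < n := by
  simp [blocks, List.getElem?_append, List.getElem?_replicate]
  grind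

theorem getElem?_blocks_eq_true {n m k : ℕ} :
    (blocks n m)[k]? = some true ↔ n ≤ k ∧ k < n + m := by
  simp [blocks, List.getElem?_append, List.getElem?_replicate]
  grind

/-- Holds of all configurations reached by `blockAutomaton` on a word `aⁿbᵐ` and a word of
length `l`. -/
def BlockInvariant (n m l : ℕ) (c : Config BlockState) : Prop :=
  match c.state with
  | .first => c.fst = c.snd ∧ c.fst ≤ n + 1
  | .second => n = l ∧ c.fst + c.snd = 2 * n + 1
  | .done => n = m

/-- At the turn the first head is at `n + 1` and the second on its end marker at `l + 1`, whence `n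
= l`. Afterwards the heads move oppositely and the sum of positions stays `2 * n + 1`; halting at
positions `n + m + 1` and `0` gives `n = m`. -/
theorem BlockInvariant.step {n m : ℕ} {v : List Bool} {c c' : Config BlockState}
    (h : BlockInvariant n m v.length c) (hs : blockAutomaton.Step (blocks n m) v c c') :
    BlockInvariant n m v.length c' := by
  obtain ⟨p, i, j⟩ := c
  obtain ⟨q, i', j'⟩ := c'
  obtain ⟨a, b, d, e, ha, hb, ht, hi, hj⟩ := hs
  change blockNext p a b = some (q, d, e) at ht
  unfold blockNext at ht
  simp only at ha hb hi hj
  split at ht <;> simp only [Option.some.injEq, Prod.mk.injEq, reduceCtorEq] at ht <;>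
    obtain ⟨rfl, rfl, rfl⟩ := ht <;>
    simp only [getElem?_tape_eq_beginMark, getElem?_tape_eq_endMark, getElem?_tape_eq_letter,
      getElem?_blocks_eq_false, getElem?_blocks_eq_true, length_blocks] at ha hb <;>
    simp only [Move.shift] at hi hj <;> simp only [BlockInvariant] at h ⊢
  · omega
  · obtain ⟨k, rfl, hk⟩ := ha
    omega
  · obtain ⟨k, rfl, hk⟩ := ha
    omega
  · omega
  · omega
  · omega

theorem eq_of_blocks_mem_accepted {n m : ℕ} {v : List Bool}
    (h : (blocks n m, v) ∈ blockAutomaton.accepted) : n = m := by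
  obtain ⟨⟨p, i, j⟩, ⟨q, i', j'⟩, ⟨hp, rfl, rfl⟩, hr, hq⟩ := Automaton.mem_accepted_iff.1 h
  obtain rfl : p = .first := hp
  obtain rfl : q = .done := hq
  suffices ∀ c, Relation.ReflTransGen (blockAutomaton.Step (blocks n m) v) ⟨.first, 0, 0⟩ c →
      BlockInvariant n m v.length c from this _ hr
  intro c hr
  induction hr with
  | refl => exact ⟨rfl, Nat.zero_le _⟩
  | tail _ hs ih => exact ih.step hs

theorem blocks_mem_accepted (n : ℕ) :
    (blocks n n, List.replicate n false) ∈ blockAutomaton.accepted := by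
  have letter {k : ℕ} (hk : k < n) :
      (tape (List.replicate n false))[k + 1]? = some (.letter false) := by
    simp [getElem?_tape_eq_letter, List.getElem?_replicate, hk]
  have run_first (k : ℕ) (hk : k ≤ n) : Relation.ReflTransGen
      (blockAutomaton.Step (blocks n n) (List.replicate n false))
      ⟨.first, 0, 0⟩ ⟨.first, k + 1, k + 1⟩ := by
    induction k with
    | zero => exact .single ⟨.beginMark, .beginMark, .right, .right, rfl, rfl, rfl, rfl, rfl⟩
    | succ k ih =>
      refine .tail (ih (by omega)) ⟨.letter false, .letter false, .right, .right, ?_,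
        letter hk, rfl, rfl, rfl⟩
      exact getElem?_tape_eq_letter.2 ⟨k, rfl, getElem?_blocks_eq_false.2 hk⟩
  have turn : blockAutomaton.Step (blocks n n) (List.replicate n false)
      ⟨.first, n + 1, n + 1⟩ ⟨.second, n + 1, n⟩ := by
    have hv : (tape (List.replicate n false))[n + 1]? = some .endMark := by
      simp [getElem?_tape_eq_endMark]
    -- For `n = 0` the second block is empty, so the first head turns on the end marker instead of
    -- on a letter.
    rcases Nat.eq_zero_or_pos n with h0 | hpos
    · refine ⟨.endMark, .endMark, .stay, .left, ?_, hv, rfl, by simp [Move.shift],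
        by simp [Move.shift]⟩
      rw [getElem?_tape_eq_endMark, length_blocks, h0]
    · refine ⟨.letter true, .endMark, .stay, .left, ?_, hv, rfl, by simp [Move.shift],
        by simp [Move.shift]⟩
      exact getElem?_tape_eq_letter.2 ⟨n, rfl, getElem?_blocks_eq_true.2 (by omega)⟩
  -- Here `k` letters of the second block have been read and `l` is the position of the second head.
  have run_second (k l : ℕ) (hkl : k + l = n) : Relation.ReflTransGen
      (blockAutomaton.Step (blocks n n) (List.replicate n false))
      ⟨.second, n + 1, n⟩ ⟨.second, n + 1 + k, l⟩ := by
    induction k generalizing l with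
    | zero =>
      obtain rfl : l = n := by omega
      exact .refl
    | succ k ih =>
      refine .tail (ih (l + 1) (by omega)) ⟨.letter true, .letter false, .right, .left, ?_,
        letter (by omega), rfl, by simp [Move.shift]; omega, by simp [Move.shift]⟩
      exact getElem?_tape_eq_letter.2 ⟨n + k, by simp only; omega,
        getElem?_blocks_eq_true.2 (by omega)⟩
  have halt : blockAutomaton.Step (blocks n n) (List.replicate n false)
      ⟨.second, n + 1 + n, 0⟩ ⟨.done, n + 1 + n, 0⟩ := by
    refine ⟨.endMark, .beginMark, .stay, .stay, ?_, rfl, rfl, by simp [Move.shift], rfl⟩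
    rw [getElem?_tape_eq_endMark, length_blocks]
    simp only
    omega
  exact Automaton.mem_accepted_iff.2 ⟨⟨.first, 0, 0⟩, _, ⟨rfl, rfl, rfl⟩,
    (((run_first n le_rfl).tail turn).trans (run_second n 0 rfl)).tail halt, rfl⟩

/-! ### Failure of closure -/

theorem comp_univ_notMem_altRec :
    blockAutomaton.accepted.comp Set.univ ∉ AltRec Bool := by
  rintro ⟨Q, _, A, hA⟩
  obtain ⟨m, n, hne, hmn⟩ :=
    A.exists_ne_forall_append_mem_accepted [] fun n => List.replicate n false
  -- The suffix `bᵐ` completes `aᵐ` to a word in the projection, but not `aⁿ`.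
  have h := hmn (List.replicate m true)
  rw [hA] at h
  obtain ⟨v, hv, -⟩ := h ⟨_, blocks_mem_accepted m, Set.mem_univ _⟩
  exact hne (eq_of_blocks_mem_accepted hv).symm

theorem not_closedUnderComposition {𝒞 : Set (SetRel (List Bool) (List Bool))}
    (h : DetRec Bool ⊆ 𝒞) (h' : 𝒞 ⊆ AltRec Bool) : ¬ ClosedUnderComposition 𝒞 := fun hc =>
  comp_univ_notMem_altRec (h' (hc _
    (h ⟨BlockState, inferInstance, blockAutomaton, blockAutomaton_isDeterministic, rfl⟩)
    _ (h univ_mem_detRec)))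

end TwoTape

theorem theorem2 :
    ∃ (α : Type) (_ : Finite α),
      ¬ TwoTape.ClosedUnderComposition (TwoTape.DetRec α) ∧
      ¬ TwoTape.ClosedUnderComposition (TwoTape.NondetRec α) ∧
      ¬ TwoTape.ClosedUnderComposition (TwoTape.AltRec α) := by
  refine ⟨Bool, inferInstance, ?_, ?_, ?_⟩ <;> apply TwoTape.not_closedUnderComposition
  · exact subset_rfl
  · exact TwoTape.detRec_subset_nondetRec.trans TwoTape.nondetRec_subset_altRec
  · exact TwoTape.detRec_subset_nondetRec
  · exact TwoTape.nondetRec_subset_altRec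
  · exact TwoTape.detRec_subset_nondetRec.trans TwoTape.nondetRec_subset_altRec
  · exact subset_rfl
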